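/- Let $q=p^e\ge 5$ be a power of an odd prime $p$, and let $q-1=(N-1)s$ with integers $N\ge 3$, $s\ge 2$ and $p\mid N$. Let $u,t,m\ge 1$ and $v\ge 0$ be integers with $v\le u$, $2u+v\le m-1$ and $m\mid q-1$. Put $r=m-u$ and $\delta=u+1$. Then there are linear codes $\mathcal C_1,\dots,\mathcal C_N\subseteq\mathbb F_q^{tm}$ and a matrix $A=(a_{ij})\in\mathbb F_q^{N\times N}$ such that the matrix-product code $$\mathcal C=[\mathcal C_1,\dots,\mathcal C_N]\cdot A=\Big\{\Big(\sum_{i}a_{i1}c_i,\ \dots,\ \sum_{i}a_{iN}c_i\Big): c_i\in\mathcal C_i\Big\}\subseteq\mathbb F_q^{Ntm}$$ is Euclidean dual-containing ($\mathcal C^{\perp}\subseteq\mathcal C$) and induces an optimal quantum $(r,\delta)$-LRC with parameters $$[[n,k,d]]_q=[[\,Ntm,\ Ntm-2Ntu-2v,\ u+v+1\,]]_q .$$ Since $t\ge1$ is arbitrary, this is an infinite family for every admissible $q,N,m,u,v$. Here a code $\mathcal C$ of length $n$ is an $(r,\delta)$-LRC if every coordinate lies in a set $S$ of at most $r+\delta-1$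 coordinates such that the restriction $\mathcal C|_S$ has minimum distance at least $\delta$ (the zero code has minimum distance $\infty$). That a Euclidean dual-containing code $\mathcal C$ induces an optimal quantum $(r,\delta)$-LRC with parameters $[[n,k,d]]_q$ means: $\mathcal C$ is an $(r,\delta)$-LRC of length $n$, dimension $\frac{n+k}2$ and minimum distance $d$, with $\delta\le d(\mathcal C^{\perp})$, such that $$k+2d+2\Big(\Big\lceil\frac{n+k}{2r}\Big\rceil-1\Big)(\delta-1)=n+2,$$ and the induced quantum (CSS) code, spanned in $(\mathbb C^q)^{\otimes n}$ by the vectors $\sum_{z\in\mathcal C^{\perp}}|x+z\rangle$ for $x\in\mathcal C$, has dimension $q^k$ and quantum minimum distance exactly $d$ (it detects all errors on fewer than $d$ qudits, but not all errors on $d$ qudits). -/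

import Mathlib

/-! ### Classical linear codes, with coordinates indexed by a finite type -/

section Classical

variable {F : Type*} [Field F] {ι : Type*} [Fintype ι]

/-- The Euclidean dual of a linear code. -/
def euclideanDual (C : Submodule F (ι → F)) : Submodule F (ι → F) where
  carrier := {x | ∀ y ∈ C, ∑ i, x i * y i = 0}
  zero_mem' := by
    intro y _
    simp
  add_mem' := by
    intro a b ha hb y hy
    simp [add_mul, Finset.sum_add_distrib, ha y hy, hb y hy]
  smul_mem' := by
    intro c a ha y hy
    simp [mul_assoc, ← Finset.mul_sum, ha y hy]

/-- The minimum distance of a linear code, i.e. the least Hamming weight of a nonzero codeword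
(`⊤` for the zero code). -/
noncomputable def minDist [DecidableEq F] (C : Submodule F (ι → F)) : ℕ∞ :=
  ⨅ c ∈ C, ⨅ _ : c ≠ 0, (hammingNorm c : ℕ∞)

/-- The code `C` punctured outside of `S`: only the coordinates in `S` are kept. -/
def punctureTo (C : Submodule F (ι → F)) (S : Finset ι) : Submodule F (S → F) :=
  C.map (LinearMap.funLeft F F (Subtype.val : S → ι))

/-- `C` is an `(r, δ)`-LRC: every coordinate `i` lies in a set `S` of at most `r + δ - 1`
coordinates such that `C` punctured to `S` has minimum distance at least `δ`. -/
def IsLRC [DecidableEq F] (C : Submodule F (ι → F)) (r δ : ℕ) : Prop :=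
  ∀ i : ι, ∃ S : Finset ι, i ∈ S ∧ S.card ≤ r + δ - 1 ∧ (δ : ℕ∞) ≤ minDist (punctureTo C S)

/-- The matrix-product code `[C₁, …, C_N] · A`: the words whose `j`-th block is
`∑ i, a_{ij} c_i`, where `c_i ∈ C_i`. The coordinate `(j, x)` is the `x`-th one of block `j`. -/
def matrixProductCode {N M : ℕ} (C : Fin N → Submodule F (ι → F))
    (A : Matrix (Fin N) (Fin M) F) : Submodule F (Fin M × ι → F) where
  carrier := {w | ∃ c : Fin N → ι → F,
    (∀ i, c i ∈ C i) ∧ ∀ j x, w (j, x) = ∑ i, A i j * c i x}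
  zero_mem' := ⟨0, fun i => (C i).zero_mem, by simp⟩
  add_mem' := by
    rintro a b ⟨c, hc, ha⟩ ⟨c', hc', hb⟩
    exact ⟨c + c', fun i => (C i).add_mem (hc i) (hc' i), fun j x => by
      simp [ha, hb, mul_add, Finset.sum_add_distrib]⟩
  smul_mem' := by
    rintro k a ⟨c, hc, ha⟩
    exact ⟨k • c, fun i => (C i).smul_mem k (hc i), fun j x => by
      simp [ha, Finset.mul_sum, mul_left_comm]⟩

end Classical

/-! ### Quantum codes

The state space `(ℂ^q)^{⊗ n}` is the space of functions `(ι → α) → ℂ`, where `ι` has `n` elements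
and the alphabet `α` has `q` elements; the inner product is the standard one. -/

section Quantum

variable {α ι : Type*} [Fintype α] [Fintype ι] [DecidableEq ι]

/-- The operator `E` on `(ℂ^q)^{⊗ n}` acts only on the qudits in `S`, that is, it has the form
`M ⊗ 1` with `M` an operator on the qudits in `S`. -/
def ActsOn (E : Matrix (ι → α) (ι → α) ℂ) (S : Finset ι) : Prop :=
  ∃ M : Matrix (S → α) (S → α) ℂ, ∀ x y : ι → α,
    ((∀ i, i ∉ S → x i = y i) → E x y = M (fun i => x i) (fun i => y i)) ∧
    ((∃ i, i ∉ S ∧ x i ≠ y i) → E x y = 0)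

/-- The quantum code `Q` detects the error `E`: with `P` the orthogonal projector onto `Q`,
`P E P` is a scalar multiple of `P`. -/
def Detects (Q : Submodule ℂ ((ι → α) → ℂ)) (E : Matrix (ι → α) (ι → α) ℂ) : Prop :=
  ∃ c : ℂ, ∀ φ ∈ Q, ∀ ψ ∈ Q, star φ ⬝ᵥ (E.mulVec ψ) = c * (star φ ⬝ᵥ ψ)

/-- `Q` is an `[[n, k, d]]_q` quantum code, with `q` the size of the alphabet: it has length `n` and
dimension `q ^ k`, it detects every error on fewer than `d` qudits, and it does not detect every
error on `d` qudits. -/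
structure IsQuantumCode (Q : Submodule ℂ ((ι → α) → ℂ)) (n k d : ℕ) : Prop where
  length_eq : Fintype.card ι = n
  finrank_eq : Module.finrank ℂ Q = Fintype.card α ^ k
  detects : ∀ S : Finset ι, S.card < d → ∀ E, ActsOn E S → Detects Q E
  not_detects : ∃ S : Finset ι, S.card = d ∧ ∃ E, ActsOn E S ∧ ¬ Detects Q E

variable {F : Type*} [Field F] [Fintype F] [DecidableEq F]

/-- The quantum code induced by a Euclidean dual-containing code `C` (the CSS construction): the
span of the (unnormalized) coset states `∑ z ∈ C^⊥, |x + z⟩` for `x ∈ C`. -/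
noncomputable def inducedQuantumCode (C : Submodule F (ι → F)) : Submodule ℂ ((ι → F) → ℂ) :=
  Submodule.span ℂ
    {ψ | ∃ x ∈ C, ψ = Set.indicator {y : ι → F | y - x ∈ euclideanDual C} (fun _ => (1 : ℂ))}

/-- The quantum code induced by the linear code `C` is an optimal quantum `(r, δ)`-LRC with
parameters `[[n, k, d]]_q`. -/
structure InducesOptimalQuantumLRC (C : Submodule F (ι → F)) (r δ n k d : ℕ) : Prop where
  r_pos : 0 < r
  one_lt_delta : 1 < δ
  dual_le : euclideanDual C ≤ C
  two_mul_finrank : 2 * Module.finrank F C = n + k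
  isLRC : IsLRC C r δ
  delta_le : (δ : ℕ∞) ≤ minDist (euclideanDual C)
  minDist_eq : minDist C = (d : ℕ∞)
  isQuantumCode : IsQuantumCode (inducedQuantumCode C) n k d
  optimal : (k : ℤ) + 2 * d + 2 * (⌈((n : ℚ) + k) / (2 * r)⌉ - 1) * ((δ : ℤ) - 1) = n + 2

end Quantum

/-! ### Duality of linear codes -/

section Duality

variable {F : Type*} [Field F] {ι : Type*} [Fintype ι]

/-! Take `N * t` blocks of length `m`, each coordinatized by the `m`-th roots of unity. A word
belongs to the code if on every block its syndromes against `X, ..., X ^ u` vanish, and its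
syndromes against `X ^ (u + 1), ..., X ^ (u + v)` vanish after summation over all blocks. The dual
consists of the evaluations of the corresponding check polynomials.

The dual lies in the code because power sums of the roots of unity vanish for exponents strictly
between `0` and `m`. This settles every pairing that involves a local check, the exponent being at
most `2 * u + v`. Two global checks pair to the same value on each block, and the number of blocks
is zero in `F` because `p ∣ N`.

The minimum distance follows from Vandermonde determinants. A nonzero block has weight at least `u +
1`; two of them give `2 * u + 2 ≥ u + v + 1`, while a single one satisfies all `u + v` checks
itself. A one-block word attains the bound outside the dual, so the CSS code has distance exactly `u
+ v + 1`.

The code is a matrix-product code: a unimodular matrix expresses "all blocks in `L`, their sum in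
`G`" with `G ≤ L`, where `L` carries only the local checks. -/

theorem dotProductBilin_nondegenerate :
    (dotProductBilin F F : LinearMap.BilinForm F (ι → F)).Nondegenerate := by
  refine ⟨fun x h => dotProduct_eq_zero x h, fun x h => dotProduct_eq_zero x fun y => ?_⟩
  rw [dotProduct_comm]
  exact h y

theorem euclideanDual_eq_orthogonal (C : Submodule F (ι → F)) :
    euclideanDual C = LinearMap.BilinForm.orthogonal (dotProductBilin F F) C := by
  ext x
  refine forall₂_congr fun y _ => ?_
  change x ⬝ᵥ y = 0 ↔ y ⬝ᵥ x = 0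
  rw [dotProduct_comm]

theorem euclideanDual_euclideanDual (C : Submodule F (ι → F)) :
    euclideanDual (euclideanDual C) = C := by
  rw [euclideanDual_eq_orthogonal, euclideanDual_eq_orthogonal]
  refine LinearMap.BilinForm.orthogonal_orthogonal dotProductBilin_nondegenerate
    (fun x y h => ?_) C
  change x ⬝ᵥ y = 0 at h
  change y ⬝ᵥ x = 0
  rwa [dotProduct_comm]

theorem finrank_euclideanDual_add (C : Submodule F (ι → F)) :
    Module.finrank F (euclideanDual C) + Module.finrank F C = Fintype.card ι := by
  rw [euclideanDual_eq_orthogonal,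
    LinearMap.BilinForm.finrank_orthogonal dotProductBilin_nondegenerate,
    Module.finrank_fintype_fun_eq_card]
  have := Submodule.finrank_le C
  rw [Module.finrank_fintype_fun_eq_card] at this
  omega

theorem eq_top_of_euclideanDual_eq_bot {C : Submodule F (ι → F)} (h : euclideanDual C = ⊥) :
    C = ⊤ := by
  rw [← euclideanDual_euclideanDual C, h, eq_top_iff]
  intro x _ y hy
  rw [Submodule.mem_bot] at hy
  simp [hy]

/-- A code whose dual distance exceeds `|S|` restricts onto all words on `S`. -/
theorem exists_mem_euclideanDual_restrict [DecidableEq F] [DecidableEq ι]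
    {C : Submodule F (ι → F)} {S : Finset ι}
    (hC : ∀ c ∈ C, c ≠ 0 → S.card < hammingNorm c) (s : S → F) :
    ∃ z ∈ euclideanDual C, ∀ i : S, z i = s i := by
  -- Puncturing is dual to shortening: a word orthogonal to the punctured dual, extended by zero,
  -- lies in `C` with weight at most `S.card`, hence vanishes.
  have htop : punctureTo (euclideanDual C) S = ⊤ := by
    refine eq_top_of_euclideanDual_eq_bot ((Submodule.eq_bot_iff _).2 fun w hw => ?_)
    let w' : ι → F := fun i => if h : i ∈ S then w ⟨i, h⟩ else 0
    have hw' : w' ∈ C := by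
      rw [← euclideanDual_euclideanDual C]
      intro y hy
      have h := hw (fun i : S => y i) ⟨y, hy, rfl⟩
      rw [← Finset.sum_subset (Finset.subset_univ S) (by intro i _ hi; simp [w', hi]),
        ← Finset.sum_coe_sort]
      simpa [w'] using h
    have hle : hammingNorm w' ≤ S.card :=
      Finset.card_le_card fun i hi => by
        by_contra h
        simp [w', h] at hi
    have hz : w' = 0 := by
      by_contra h
      exact absurd (hC w' hw' h) (not_lt.2 hle)
    ext i
    simpa [w'] using congrFun hz i
  obtain ⟨z, hz, hzs⟩ := htop.ge (Submodule.mem_top (x := s))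
  exact ⟨z, hz, fun i => congrFun hzs i⟩

end Duality

/-! ### Coset states and the CSS construction -/

section CosetState

variable {F : Type*} [Field F] {ι : Type*} [Fintype ι] {C : Submodule F (ι → F)}

/-- The coset state of `x`. -/
noncomputable def cosetState (C : Submodule F (ι → F)) (x : ι → F) : (ι → F) → ℂ :=
  Set.indicator {y : ι → F | y - x ∈ euclideanDual C} (fun _ => (1 : ℂ))

theorem cosetState_apply_of_mem {x y : ι → F} (h : y - x ∈ euclideanDual C) :
    cosetState C x y = 1 := Set.indicator_of_mem (s := {y | y - x ∈ euclideanDual C}) h _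

theorem cosetState_apply_of_notMem {x y : ι → F} (h : y - x ∉ euclideanDual C) :
    cosetState C x y = 0 := Set.indicator_of_notMem (s := {y | y - x ∈ euclideanDual C}) h _

theorem cosetState_eq_of_sub_mem {x y : ι → F} (h : x - y ∈ euclideanDual C) :
    cosetState C x = cosetState C y := by
  ext z
  have : z - x ∈ euclideanDual C ↔ z - y ∈ euclideanDual C := by
    rw [← sub_add_sub_cancel z x y, Submodule.add_mem_iff_left _ h]
  by_cases hz : z - x ∈ euclideanDual C
  · rw [cosetState_apply_of_mem hz, cosetState_apply_of_mem (this.1 hz)]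
  · rw [cosetState_apply_of_notMem hz, cosetState_apply_of_notMem (this.not.1 hz)]

theorem cosetState_mem {x : ι → F} (hx : x ∈ C) : cosetState C x ∈ inducedQuantumCode C :=
  Submodule.subset_span ⟨x, hx, rfl⟩

theorem apply_eq_zero_of_mem_inducedQuantumCode (hdual : euclideanDual C ≤ C)
    {φ : (ι → F) → ℂ} (hφ : φ ∈ inducedQuantumCode C) {x : ι → F} (hx : x ∉ C) : φ x = 0 := by
  induction hφ using Submodule.span_induction with
  | mem φ h =>
    obtain ⟨a, ha, rfl⟩ := h
    refine cosetState_apply_of_notMem fun h => hx ?_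
    simpa using C.add_mem (hdual h) ha
  | zero => rfl
  | add φ ψ _ _ h₁ h₂ => simp [h₁, h₂]
  | smul c φ _ h => simp [h]

theorem apply_add_of_mem_inducedQuantumCode
    {φ : (ι → F) → ℂ} (hφ : φ ∈ inducedQuantumCode C) (x : ι → F) {z : ι → F}
    (hz : z ∈ euclideanDual C) : φ (x + z) = φ x := by
  induction hφ using Submodule.span_induction with
  | mem φ h =>
    obtain ⟨a, ha, rfl⟩ := h
    change cosetState C a (x + z) = cosetState C a x
    have : x + z - a ∈ euclideanDual C ↔ x - a ∈ euclideanDual C := by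
      rw [add_sub_right_comm, Submodule.add_mem_iff_left _ hz]
    by_cases h : x - a ∈ euclideanDual C
    · rw [cosetState_apply_of_mem h, cosetState_apply_of_mem (this.2 h)]
    · rw [cosetState_apply_of_notMem h, cosetState_apply_of_notMem (this.not.2 h)]
  | zero => rfl
  | add φ ψ _ _ h₁ h₂ => simp [h₁, h₂]
  | smul c φ _ h => simp [h]

end CosetState

section CSS

variable {F : Type*} [Field F] [Fintype F] {ι : Type*} [Fintype ι] [DecidableEq ι]
  {C : Submodule F (ι → F)}

/-- Coset states of distinct classes in `C ⧸ C^⊥` have disjoint supports, so they form a basis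
indexed by this quotient, whose dimension is `2 * finrank C - n = k`. -/
theorem finrank_inducedQuantumCode (hdual : euclideanDual C ≤ C) {k : ℕ}
    (hk : 2 * Module.finrank F C = Fintype.card ι + k) :
    Module.finrank ℂ (inducedQuantumCode C) = Fintype.card F ^ k := by
  classical
  let D : Submodule F C := (euclideanDual C).comap C.subtype
  let b : C ⧸ D → (ι → F) → ℂ := fun a => cosetState C (a.out : C)
  have hout (x : C) : ((Submodule.Quotient.mk x : C ⧸ D).out : ι → F) - x ∈ euclideanDual C := by
    have : Submodule.Quotient.mk (Submodule.Quotient.mk x : C ⧸ D).out =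
      (Submodule.Quotient.mk x : C ⧸ D) := Quotient.out_eq _
    exact (Submodule.Quotient.eq D).1 this
  have hspan : inducedQuantumCode C = Submodule.span ℂ (Set.range b) := by
    refine congrArg _ (Set.ext fun ψ => ⟨?_, ?_⟩)
    · rintro ⟨x, hx, rfl⟩
      exact ⟨Submodule.Quotient.mk ⟨x, hx⟩, cosetState_eq_of_sub_mem (hout ⟨x, hx⟩)⟩
    · rintro ⟨a, rfl⟩
      exact ⟨_, a.out.2, rfl⟩
  have hb (a a' : C ⧸ D) : b a (a'.out : C) = if a = a' then 1 else 0 := by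
    split_ifs with h
    · subst h
      exact cosetState_apply_of_mem (by simp)
    · refine cosetState_apply_of_notMem fun h' => h ?_
      have : (Submodule.Quotient.mk a'.out : C ⧸ D) = Submodule.Quotient.mk a.out :=
        (Submodule.Quotient.eq D).2 h'
      rw [← Quotient.out_eq a, ← Quotient.out_eq a']
      exact this.symm
  have hli : LinearIndependent ℂ b := by
    rw [Fintype.linearIndependent_iff]
    intro g hg a
    have := congrFun hg (a.out : C)
    simpa [Finset.sum_apply, hb] using this
  rw [hspan, finrank_span_eq_card hli, Module.card_eq_pow_finrank (K := F)]
  congr 1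
  have h₁ := D.finrank_quotient_add_finrank
  have h₂ : Module.finrank F D = Module.finrank F (euclideanDual C) :=
    (Submodule.comapSubtypeEquivOfLe hdual).finrank_eq
  have h₃ := finrank_euclideanDual_add C
  omega

variable [DecidableEq F]

/-- If `f` is invariant under translations that realize all words on `S`, then the sum of `f`
against a function of the restriction to `S` only depends on the sum of `f`. -/
theorem sum_comp_restrict_mul {S : Finset ι} {f : (ι → F) → ℂ}
    (hf : ∀ s : S → F, ∃ z : ι → F, (∀ i : S, z i = s i) ∧ ∀ x, f (x + z) = f x)
    (h : (S → F) → ℂ) :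
    ∑ x : ι → F, h (fun i => x i) * f x = (∑ s, h s) / Fintype.card (S → F) * ∑ x, f x := by
  let π : (ι → F) → S → F := fun x i => x i
  -- Translation by `z` carries the fiber of `π` over `0` onto the fiber over `s`, so `f` has the
  -- same sum on all fibers.
  have hT (s : S → F) : ∑ x with π x = s, f x = ∑ x with π x = 0, f x := by
    obtain ⟨z, hzs, hz⟩ := hf s
    have hπz : π z = s := funext hzs
    have hπ (x : ι → F) : π (x + z) = π x + s := by rw [← hπz]; rfl
    rw [Finset.sum_filter, Finset.sum_filter, ← Equiv.sum_comp (Equiv.addRight z)]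
    refine Finset.sum_congr rfl fun x _ => ?_
    rw [Equiv.coe_addRight, hz, hπ]
    simp
  have h₁ : ∑ x, f x = Fintype.card (S → F) * ∑ x with π x = 0, f x := by
    rw [← Finset.sum_fiberwise _ π, Finset.sum_congr rfl fun s _ => hT s, Finset.sum_const,
      Finset.card_univ, nsmul_eq_mul]
  have h₂ : ∑ x : ι → F, h (π x) * f x = (∑ s, h s) * ∑ x with π x = 0, f x := by
    rw [← Finset.sum_fiberwise _ π, Finset.sum_mul]
    refine Finset.sum_congr rfl fun s _ => ?_
    rw [← hT s, Finset.mul_sum]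
    refine Finset.sum_congr rfl fun x hx => ?_
    rw [(Finset.mem_filter.1 hx).2]
  have hcard : (Fintype.card (S → F) : ℂ) ≠ 0 := Nat.cast_ne_zero.2 Fintype.card_ne_zero
  rw [h₁, ← mul_assoc, div_mul_cancel₀ _ hcard]
  exact h₂

/-- Two codewords that differ only inside `S` are equal, so on the code `E` contributes only its
diagonal entries, which depend on the restriction to `S`. Invariance of code states under `C^⊥`,
which restricts onto all words on `S`, replaces these entries by their average. -/
theorem detects_inducedQuantumCode (hdual : euclideanDual C ≤ C) {S : Finset ι}
    (hC : ∀ c ∈ C, c ≠ 0 → S.card < hammingNorm c)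
    {E : Matrix (ι → F) (ι → F) ℂ} (hE : ActsOn E S) : Detects (inducedQuantumCode C) E := by
  obtain ⟨M, hM⟩ := hE
  refine ⟨(∑ s, M s s) / Fintype.card (S → F), fun φ hφ ψ hψ => ?_⟩
  have hdiag (x : ι → F) (hx : x ∈ C) :
      E.mulVec ψ x = M (fun i => x i) (fun i => x i) * ψ x := by
    rw [Matrix.mulVec, dotProduct, Finset.sum_eq_single x, (hM x x).1 fun _ _ => rfl]
    · intro y _ hyx
      by_cases hy : y ∈ C
      · rw [(hM x y).2, zero_mul]
        by_contra! h
        refine absurd (hC (x - y) (C.sub_mem hx hy) (sub_ne_zero.2 hyx.symm)) (not_lt.2 ?_)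
        refine Finset.card_le_card fun i hi => ?_
        by_contra hiS
        simp [h i hiS] at hi
      · rw [apply_eq_zero_of_mem_inducedQuantumCode hdual hψ hy, mul_zero]
    · simp
  have hsum := sum_comp_restrict_mul (S := S) (f := fun x => star (φ x) * ψ x)
    (fun s => ?_) (fun s => M s s)
  · refine Eq.trans (Finset.sum_congr rfl fun x _ => ?_) hsum
    by_cases hx : x ∈ C
    · rw [hdiag x hx, Pi.star_apply]
      ring
    · simp [apply_eq_zero_of_mem_inducedQuantumCode hdual hφ hx]
  · obtain ⟨z, hz, hzs⟩ := exists_mem_euclideanDual_restrict hC s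
    exact ⟨z, hzs, fun x => by
      rw [apply_add_of_mem_inducedQuantumCode hφ x hz,
        apply_add_of_mem_inducedQuantumCode hψ x hz]⟩

open scoped ComplexOrder in
-- The error is the shift `|y⟩ ↦ |y + c⟩`. It sends the coset state of `0` to that of `c`, which is
-- nonzero and orthogonal to it since `c ∉ C^⊥`; no scalar accounts for this matrix element.
theorem exists_not_detects_inducedQuantumCode {c : ι → F} (hc : c ∈ C)
    (hcD : c ∉ euclideanDual C) :
    ∃ E, ActsOn E (Finset.univ.filter fun i => c i ≠ 0) ∧ ¬ Detects (inducedQuantumCode C) E := by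
  refine ⟨Matrix.of fun x y => if x - y = c then 1 else 0,
    ⟨fun a b => if a - b = Finset.restrict _ c then 1 else 0, fun x y => ⟨?_, ?_⟩⟩, ?_⟩
  · intro h
    have : x - y = c ↔ Finset.restrict (Finset.univ.filter fun i => c i ≠ 0) (x - y) =
        Finset.restrict (Finset.univ.filter fun i => c i ≠ 0) c := by
      refine ⟨fun h => congrArg _ h, fun h' => funext fun i => ?_⟩
      by_cases hi : c i = 0
      · simp [hi, h i (by simp [hi])]
      · exact congrFun h' ⟨i, by simp [hi]⟩
    exact if_congr this rfl rfl
  · rintro ⟨i, hi, hxy⟩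
    rw [Matrix.of_apply, if_neg]
    intro h
    have hi : c i = 0 := by simpa using hi
    exact hxy (sub_eq_zero.1 ((congrFun h i).trans hi))
  · rintro ⟨a, ha⟩
    have h := ha _ (cosetState_mem hc) _ (cosetState_mem C.zero_mem)
    have h₀ : star (cosetState C c) ⬝ᵥ cosetState C 0 = 0 := by
      refine Finset.sum_eq_zero fun x _ => ?_
      by_cases hx : x ∈ euclideanDual C
      · rw [Pi.star_apply, cosetState_apply_of_notMem, star_zero, zero_mul]
        exact fun h => hcD (by simpa using (euclideanDual C).sub_mem hx h)
      · rw [cosetState_apply_of_notMem (x := 0) (by simpa using hx), mul_zero]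
    have hmul (x : ι → F) : (Matrix.of fun x y : ι → F => if x - y = c then (1 : ℂ) else 0).mulVec
        (cosetState C 0) x = cosetState C c x := by
      rw [Matrix.mulVec, dotProduct, Finset.sum_eq_single (x - c)]
      · by_cases hx : x - c ∈ euclideanDual C
        · rw [cosetState_apply_of_mem hx, cosetState_apply_of_mem (by simpa using hx)]
          simp
        · rw [cosetState_apply_of_notMem hx, cosetState_apply_of_notMem (by simpa using hx),
            mul_zero]
      · intro y _ hy
        rw [Matrix.of_apply, if_neg, zero_mul]
        rintro rfl
        simp at hy
      · simp
    rw [h₀, mul_zero, funext hmul, dotProduct_star_self_eq_zero] at h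
    have := congrFun h c
    rw [cosetState_apply_of_mem (by simp)] at this
    simp at this

/-- The CSS construction: a dual-containing code with a minimum weight codeword outside of its
dual. -/
theorem isQuantumCode_inducedQuantumCode {k d : ℕ} (hdual : euclideanDual C ≤ C)
    (hk : 2 * Module.finrank F C = Fintype.card ι + k)
    (hd : ∀ c ∈ C, c ≠ 0 → d ≤ hammingNorm c)
    (hex : ∃ c ∈ C, c ∉ euclideanDual C ∧ hammingNorm c = d) :
    IsQuantumCode (inducedQuantumCode C) (Fintype.card ι) k d where
  length_eq := rfl
  finrank_eq := finrank_inducedQuantumCode hdual hk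
  detects _ hS _ hE :=
    detects_inducedQuantumCode hdual (fun c hc h => hS.trans_le (hd c hc h)) hE
  not_detects := by
    obtain ⟨c, hc, hcD, rfl⟩ := hex
    exact ⟨_, rfl, exists_not_detects_inducedQuantumCode hc hcD⟩

end CSS

/-! ### Vandermonde weight bounds -/

section Vandermonde

variable {F : Type*} [Field F] [DecidableEq F] {κ : Type*} [Fintype κ] {x : κ → F}

/-- The BCH bound: on a support of size at most `k` the equations contain an invertible Vandermonde
system. Exponents start at `1`, so the unknowns are `y a * x a`, which is harmless because `x a ≠
0`. -/
theorem lt_hammingNorm_of_forall_sum_mul_pow_eq_zero (hx : Function.Injective x)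
    (hx₀ : ∀ a, x a ≠ 0) {k : ℕ} {y : κ → F} (hy : y ≠ 0)
    (h : ∀ i < k, ∑ a, y a * x a ^ (i + 1) = 0) : k < hammingNorm y := by
  by_contra! hk
  let T : Finset κ := Finset.univ.filter fun a => y a ≠ 0
  have hT : T.card = hammingNorm y := rfl
  let g : Fin T.card → κ := fun j => (T.equivFin.symm j : κ)
  have hg : Function.Injective g := Subtype.val_injective.comp T.equivFin.symm.injective
  have hv := Matrix.eq_zero_of_forall_pow_sum_mul_pow_eq_zero (f := x ∘ g)
    (v := fun j => y (g j) * x (g j)) (hx.comp hg) fun i => by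
      rw [← h i (by omega)]
      refine Fintype.sum_of_injective g hg _ _ (fun a ha => ?_) fun j => by
        simp only [Function.comp_apply]
        ring
      have : a ∉ T := fun haT => ha ⟨T.equivFin ⟨a, haT⟩, by simp [g]⟩
      have : y a = 0 := by simpa [T] using this
      rw [this, zero_mul]
  obtain ⟨a, ha⟩ := Function.ne_iff.1 hy
  have haT : a ∈ T := by simpa [T] using ha
  have := congrFun hv (T.equivFin ⟨a, haT⟩)
  simp [g, hx₀] at this
  exact ha this

/-- After division by `X`, a nonzero polynomial of degree less than `k` remains, with fewer than `k`
zeros among the points. -/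
theorem card_lt_hammingNorm_add_of_sum_mul_pow (hx : Function.Injective x)
    (hx₀ : ∀ a, x a ≠ 0) {k : ℕ} {c : Fin k → F} (hc : c ≠ 0) :
    Fintype.card κ < hammingNorm (fun a => ∑ i, c i * x a ^ (i + 1 : ℕ)) + k := by
  by_contra! hk
  let y : κ → F := fun a => ∑ i, c i * x a ^ (i + 1 : ℕ)
  let Z : Finset κ := Finset.univ.filter fun a => ¬ y a ≠ 0
  have hZ : hammingNorm y + Z.card = Fintype.card κ :=
    Finset.card_filter_add_card_filter_not _
  have hkZ : k ≤ Z.card := by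
    change hammingNorm y + k ≤ _ at hk
    omega
  let g : Fin k → κ := fun j => (Z.equivFin.symm (Fin.castLE hkZ j) : κ)
  have hg : Function.Injective g :=
    Subtype.val_injective.comp (Z.equivFin.symm.injective.comp (Fin.castLE_injective hkZ))
  refine hc (Matrix.eq_zero_of_forall_index_sum_mul_pow_eq_zero (f := x ∘ g) (hx.comp hg)
    fun j => ?_)
  have hj : y (g j) = 0 := by
    have := (Z.equivFin.symm (Fin.castLE hkZ j)).2
    simpa [Z] using this
  refine (mul_eq_zero.1 ?_).resolve_right (hx₀ (g j))
  rw [← hj, Finset.sum_mul]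
  refine Finset.sum_congr rfl fun i _ => ?_
  simp only [Function.comp_apply]
  ring

/-- On `k + 1` chosen coordinates, `k` homogeneous equations have a nonzero solution; it is extended
by zero. -/
theorem exists_hammingNorm_le_and_sum_mul_pow_eq_zero (x : κ → F) {k : ℕ}
    (hk : k < Fintype.card κ) : ∃ y : κ → F, y ≠ 0 ∧ hammingNorm y ≤ k + 1 ∧
      ∀ i < k, ∑ a, y a * x a ^ (i + 1) = 0 := by
  classical
  obtain ⟨g⟩ := Function.Embedding.nonempty_of_card_le
    (α := Fin (k + 1)) (β := κ) (by simpa using hk)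
  let M : Matrix (Fin k) (Fin (k + 1)) F := Matrix.of fun i j => x (g j) ^ (i + 1 : ℕ)
  have hker := LinearMap.ker_ne_bot_of_finrank_lt (f := M.mulVecLin) (by simp)
  obtain ⟨z, hz, hz₀⟩ := (Submodule.ne_bot_iff _).1 hker
  refine ⟨Function.extend g z 0, fun h => hz₀ (funext fun j => ?_), ?_, fun i hi => ?_⟩
  · rw [← g.injective.extend_apply z 0, h]
    rfl
  · refine (Finset.card_le_card (t := Finset.univ.image g) fun a ha => ?_).trans
      (Finset.card_image_le.trans (by simp))
    by_contra hag
    simp only [Finset.mem_filter, Finset.mem_univ, true_and] at ha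
    refine ha (Function.extend_apply' _ _ _ fun ⟨j, hj⟩ => hag ?_)
    exact Finset.mem_image.2 ⟨j, Finset.mem_univ j, hj⟩
  · refine Eq.trans ?_ (congrFun (LinearMap.mem_ker.1 hz) ⟨i, hi⟩)
    refine (Fintype.sum_of_injective g g.injective _ _ (fun a ha => ?_) fun j => ?_).symm
    · rw [Function.extend_apply' _ _ _ ha, Pi.zero_apply, zero_mul]
    · simp only [g.injective.extend_apply, M, Matrix.of_apply]
      ring

end Vandermonde

theorem hammingNorm_eq_sum_blocks {F : Type*} [Zero F] [DecidableEq F] {B κ ι : Type*} [Fintype B]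
    [Fintype κ] [Fintype ι] (e : B × κ ≃ ι) (w : ι → F) :
    hammingNorm w = ∑ b, hammingNorm fun a => w (e (b, a)) := by
  simp only [hammingNorm, Finset.card_filter]
  rw [← Equiv.sum_comp e, Fintype.sum_prod_type]

/-! ### Codes with local and global checks -/

section Codes

variable {F : Type*} [Field F] {B κ ι : Type*} (e : B × κ ≃ ι) (x : κ → F) (u v : ℕ)

/-- The word whose blocks evaluate at the points `x a` the polynomials
`∑ l < u, h₁ b l X ^ (l + 1) + ∑ l < v, h₂ l X ^ (u + l + 1)`. -/
def checkWord : ((B → Fin u → F) × (Fin v → F)) →ₗ[F] (ι → F) where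
  toFun h j := ∑ l, h.1 (e.symm j).1 l * x (e.symm j).2 ^ (l + 1 : ℕ) +
    ∑ l, h.2 l * x (e.symm j).2 ^ (u + l + 1 : ℕ)
  map_add' h h' := by
    ext j
    simp only [Prod.fst_add, Prod.snd_add, Pi.add_apply, add_mul, Finset.sum_add_distrib]
    ring
  map_smul' c h := by
    ext j
    simp [mul_add, Finset.mul_sum, mul_assoc]

/-- The code with `u` local checks on each block and `v` global checks. -/
def localGlobalCode [Fintype ι] : Submodule F (ι → F) :=
  euclideanDual (LinearMap.range (checkWord e x u v))

variable {u v} in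
theorem checkWord_apply (h : (B → Fin u → F) × (Fin v → F)) (b : B) (a : κ) :
    checkWord e x u v h (e (b, a)) =
      ∑ l, Fin.append (h.1 b) h.2 l * x a ^ (l + 1 : ℕ) := by
  simp [checkWord, Fin.sum_univ_add]

theorem euclideanDual_localGlobalCode [Fintype ι] :
    euclideanDual (localGlobalCode e x u v) = LinearMap.range (checkWord e x u v) :=
  euclideanDual_euclideanDual _

theorem append_ne_zero_of_ne_zero [Nonempty B] {u v : ℕ} {h : (B → Fin u → F) × (Fin v → F)} (hh : h ≠ 0) :
    ∃ b, Fin.append (h.1 b) h.2 ≠ 0 := by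
  by_contra! H
  refine hh (Prod.ext (funext fun b => funext fun l => ?_) (funext fun l => ?_))
  · simpa using congrFun (H b) (Fin.castAdd v l)
  · simpa using congrFun (H (Classical.arbitrary B)) (Fin.natAdd u l)

theorem exists_block_ne_zero {e : B × κ ≃ ι} {w : ι → F} (hw : w ≠ 0) : ∃ b, (fun a => w (e (b, a))) ≠ 0 := by
  obtain ⟨i, hi⟩ := Function.ne_iff.1 hw
  exact ⟨(e.symm i).1, Function.ne_iff.2 ⟨(e.symm i).2, by simpa using hi⟩⟩

variable [Fintype κ]

/-- The `i`-th syndrome of the block `b` of the word `w`. -/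
def blockSyndrome (w : ι → F) (b : B) (i : ℕ) : F :=
  ∑ a, w (e (b, a)) * x a ^ (i + 1)

variable {e x u v}

theorem card_lt_hammingNorm_checkWord_block_add [DecidableEq F]
    (hx : Function.Injective x) (hx₀ : ∀ a, x a ≠ 0) {h : (B → Fin u → F) × (Fin v → F)} {b : B}
    (hb : Fin.append (h.1 b) h.2 ≠ 0) :
    Fintype.card κ < hammingNorm (fun a => checkWord e x u v h (e (b, a))) + (u + v) := by
  simp only [checkWord_apply]
  exact card_lt_hammingNorm_add_of_sum_mul_pow hx hx₀ hb

variable [Fintype B] [Fintype ι]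

theorem sum_mul_checkWord (w : ι → F) (h : (B → Fin u → F) × (Fin v → F)) :
    ∑ j, w j * checkWord e x u v h j = ∑ b, ∑ l, h.1 b l * blockSyndrome e x w b l +
      ∑ l, h.2 l * ∑ b, blockSyndrome e x w b (u + l) := by
  have hb (b : B) : ∑ a, w (e (b, a)) * checkWord e x u v h (e (b, a)) =
      ∑ l, h.1 b l * blockSyndrome e x w b l + ∑ l, h.2 l * blockSyndrome e x w b (u + l) := by
    simp only [checkWord_apply, Fin.sum_univ_add, Fin.append_left, Fin.append_right,
      Fin.val_castAdd, Fin.val_natAdd, blockSyndrome, Finset.mul_sum, mul_add,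
      Finset.sum_add_distrib]
    rw [Finset.sum_comm, Finset.sum_comm (s := Finset.univ (α := κ)) (t := Finset.univ (α := Fin v))]
    simp only [mul_left_comm]
  rw [← Equiv.sum_comp e, Fintype.sum_prod_type]
  simp only [hb, Finset.sum_add_distrib, Finset.mul_sum]
  rw [Finset.sum_comm (s := Finset.univ (α := B)) (t := Finset.univ (α := Fin v))]

theorem mem_localGlobalCode {w : ι → F} : w ∈ localGlobalCode e x u v ↔
    (∀ b, ∀ i < u, blockSyndrome e x w b i = 0) ∧
      ∀ i < v, ∑ b, blockSyndrome e x w b (u + i) = 0 := by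
  classical
  constructor
  · intro hw
    have key (h) : ∑ j, w j * checkWord e x u v h j = 0 := hw _ ⟨h, rfl⟩
    simp only [sum_mul_checkWord] at key
    refine ⟨fun b i hi => ?_, fun i hi => ?_⟩
    · have := key (Pi.single b (Pi.single ⟨i, hi⟩ 1), 0)
      simpa [Pi.single_apply, apply_ite, ite_apply, Finset.sum_ite_eq] using this
    · have := key (0, Pi.single ⟨i, hi⟩ 1)
      simpa [Pi.single_apply] using this
  · rintro ⟨h₁, h₂⟩ _ ⟨h, rfl⟩
    rw [sum_mul_checkWord]
    simp [h₁, h₂]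

/-- The syndromes of a check word are combinations of power sums of the points; `hpow` kills all of
them except possibly those pairing two global checks. -/
theorem range_checkWord_le_localGlobalCode
    (hpow : ∀ n, 0 < n → n < Fintype.card κ → ∑ a, x a ^ n = 0)
    (huv : 2 * u + v < Fintype.card κ) (hB : (Fintype.card B : F) = 0) :
    LinearMap.range (checkWord e x u v) ≤ localGlobalCode e x u v := by
  rintro _ ⟨h, rfl⟩
  have hsyn (b : B) (i : ℕ) : blockSyndrome e x (checkWord e x u v h) b i =
      ∑ l, Fin.append (h.1 b) h.2 l * ∑ a, x a ^ (l + 1 + (i + 1) : ℕ) := by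
    simp only [blockSyndrome, checkWord_apply, Finset.sum_mul, Finset.mul_sum]
    rw [Finset.sum_comm]
    simp only [mul_assoc, pow_add]
  rw [mem_localGlobalCode]
  refine ⟨fun b i hi => ?_, fun i hi => ?_⟩
  · rw [hsyn]
    refine Finset.sum_eq_zero fun l _ => ?_
    rw [hpow _ (by omega) (by omega), mul_zero]
  -- The exponent `u + l + 1 + (u + i + 1)` may reach `Fintype.card κ`, so `hpow` need not apply.
  -- The remaining expression does not depend on `b`, and the sum over `B` vanishes by `hB`.
  · have hl (b : B) : blockSyndrome e x (checkWord e x u v h) b (u + i) =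
        ∑ l, h.2 l * ∑ a, x a ^ (u + l + 1 + (u + i + 1) : ℕ) := by
      rw [hsyn, Fin.sum_univ_add, Finset.sum_eq_zero, zero_add]
      · simp
      · intro l _
        rw [hpow _ (by omega) (by rw [Fin.val_castAdd]; omega), mul_zero]
    simp only [hl, Finset.sum_const, Finset.card_univ, nsmul_eq_mul, hB, zero_mul]

/-- The checks are independent: a nonzero `h` gives on some block a nonzero polynomial with too few
zeros to vanish at all points. -/
theorem finrank_localGlobalCode_add [Nonempty B] (hx : Function.Injective x) (hx₀ : ∀ a, x a ≠ 0)
    (huv : u + v ≤ Fintype.card κ) :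
    Module.finrank F (localGlobalCode e x u v) + (Fintype.card B * u + v) = Fintype.card ι := by
  classical
  rw [← finrank_euclideanDual_add (LinearMap.range (checkWord e x u v)), localGlobalCode,
    LinearMap.finrank_range_of_inj]
  · simp [Module.finrank_pi_fintype]
  · refine (injective_iff_map_eq_zero _).2 fun h hh => ?_
    by_contra hne
    obtain ⟨b, hb⟩ := append_ne_zero_of_ne_zero hne
    have := card_lt_hammingNorm_checkWord_block_add (e := e) hx hx₀ hb
    simp only [hh, Pi.zero_apply] at this
    change _ < hammingNorm (0 : κ → F) + _ at this
    rw [hammingNorm_zero] at this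
    omega

section MinDist

variable [DecidableEq F]

theorem hammingNorm_block_le (w : ι → F) (b : B) :
    hammingNorm (fun a => w (e (b, a))) ≤ hammingNorm w := by
  rw [hammingNorm_eq_sum_blocks e w]
  exact Finset.single_le_sum (f := fun b => hammingNorm fun a => w (e (b, a)))
    (fun _ _ => Nat.zero_le _) (Finset.mem_univ b)

theorem add_one_le_minDist_euclideanDual_localGlobalCode [Nonempty B] (hx : Function.Injective x)
    (hx₀ : ∀ a, x a ≠ 0) (huv : 2 * u + v < Fintype.card κ) :
    ((u + 1 : ℕ) : ℕ∞) ≤ minDist (euclideanDual (localGlobalCode e x u v)) := by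
  rw [euclideanDual_localGlobalCode]
  refine le_iInf₂ fun c hc => le_iInf fun hc₀ => ?_
  obtain ⟨h, rfl⟩ := hc
  obtain ⟨b, hb⟩ := append_ne_zero_of_ne_zero (h := h) (by rintro rfl; simp at hc₀)
  have h₁ := card_lt_hammingNorm_checkWord_block_add (e := e) hx hx₀ hb
  have h₂ := hammingNorm_block_le (e := e) (checkWord e x u v h) b
  exact_mod_cast (by omega : u + 1 ≤ hammingNorm (checkWord e x u v h))

theorem lt_hammingNorm_block {w : ι → F} (hx : Function.Injective x) (hx₀ : ∀ a, x a ≠ 0)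
    (hw : w ∈ localGlobalCode e x u v) {b : B} (hb : (fun a => w (e (b, a))) ≠ 0) :
    u < hammingNorm fun a => w (e (b, a)) :=
  lt_hammingNorm_of_forall_sum_mul_pow_eq_zero hx hx₀ hb ((mem_localGlobalCode.1 hw).1 b)

/-- The recovery set of a coordinate is its block, of size `r + u = r + (u + 1) - 1`. -/
theorem isLRC_localGlobalCode (hx : Function.Injective x) (hx₀ : ∀ a, x a ≠ 0) {r : ℕ}
    (hr : r + u = Fintype.card κ) : IsLRC (localGlobalCode e x u v) r (u + 1) := by
  intro i
  obtain ⟨⟨b, a₀⟩, rfl⟩ := e.surjective i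
  let g : κ ↪ ι := ⟨fun a => e (b, a), fun a a' h => by simpa using h⟩
  have hg (a : κ) : e (b, a) ∈ Finset.univ.map g := Finset.mem_map_of_mem g (Finset.mem_univ a)
  refine ⟨Finset.univ.map g, hg a₀, ?_, ?_⟩
  · rw [Finset.card_map, Finset.card_univ]
    omega
  refine le_iInf₂ fun c hc => le_iInf fun hc₀ => ?_
  obtain ⟨w, hw, rfl⟩ := hc
  have hb : (fun a => w (e (b, a))) ≠ 0 := by
    obtain ⟨⟨j, hj⟩, hne⟩ := Function.ne_iff.1 hc₀
    obtain ⟨a, -, rfl⟩ := Finset.mem_map.1 hj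
    exact Function.ne_iff.2 ⟨a, hne⟩
  have h₁ := lt_hammingNorm_block hx hx₀ hw hb
  refine Nat.cast_le.2 (h₁.trans_le ?_)
  refine Finset.card_le_card_of_injOn (fun a => ⟨e (b, a), hg a⟩) (fun a ha => ?_)
    fun a _ a' _ h => by simpa using h
  have ha' : w (e (b, a)) ≠ 0 := by simpa using ha
  exact Finset.mem_coe.2 (Finset.mem_filter.2 ⟨Finset.mem_univ _, ha'⟩)

/-- Two nonzero blocks have total weight at least `2 * (u + 1)`, enough as `v ≤ u`. With a single
nonzero block the global checks become checks on that block, and the BCH bound applies with `u + v`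
consecutive exponents. -/
theorem lt_hammingNorm_of_mem_localGlobalCode (hx : Function.Injective x) (hx₀ : ∀ a, x a ≠ 0)
    (hvu : v ≤ u) {w : ι → F} (hw : w ∈ localGlobalCode e x u v) (hw₀ : w ≠ 0) :
    u + v < hammingNorm w := by
  classical
  obtain ⟨b, hb⟩ := exists_block_ne_zero (e := e) hw₀
  by_cases hb' : ∃ b', b' ≠ b ∧ (fun a => w (e (b', a))) ≠ 0
  · obtain ⟨b', hne, hb'⟩ := hb'
    have h₁ := lt_hammingNorm_block hx hx₀ hw hb
    have h₂ := lt_hammingNorm_block hx hx₀ hw hb'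
    have h₃ := Finset.sum_le_sum_of_subset (f := fun b => hammingNorm fun a => w (e (b, a)))
      (Finset.subset_univ {b', b})
    rw [Finset.sum_pair hne, ← hammingNorm_eq_sum_blocks] at h₃
    omega
  · push Not at hb'
    have hsyn (i : ℕ) : ∑ b', blockSyndrome e x w b' i = blockSyndrome e x w b i := by
      refine Finset.sum_eq_single b (fun b' _ hne => ?_) (by simp)
      refine Finset.sum_eq_zero fun a _ => ?_
      have := congrFun (hb' b' hne) a
      simp only [Pi.zero_apply] at this
      rw [this, zero_mul]
    obtain ⟨h₁, h₂⟩ := mem_localGlobalCode.1 hw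
    refine (lt_hammingNorm_of_forall_sum_mul_pow_eq_zero hx hx₀ hb fun i hi => ?_).trans_le
      (hammingNorm_block_le w b)
    rcases lt_or_ge i u with hiu | hiu
    · exact h₁ b i hiu
    · obtain ⟨l, rfl⟩ := Nat.exists_eq_add_of_le hiu
      exact (hsyn _).symm.trans (h₂ l (by omega))

theorem exists_minimum_weight_word [Nontrivial B] (hx : Function.Injective x)
    (hx₀ : ∀ a, x a ≠ 0) (huv : 2 * u + v < Fintype.card κ) :
    ∃ w ∈ localGlobalCode e x u v, w ∉ LinearMap.range (checkWord e x u v) ∧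
      hammingNorm w = u + v + 1 := by
  classical
  obtain ⟨y, hy₀, hyle, hy⟩ :=
    exists_hammingNorm_le_and_sum_mul_pow_eq_zero x (k := u + v) (by omega)
  have hylt := lt_hammingNorm_of_forall_sum_mul_pow_eq_zero hx hx₀ hy₀ hy
  obtain ⟨b, b', hne⟩ := exists_pair_ne B
  let w : ι → F := fun i => if (e.symm i).1 = b then y (e.symm i).2 else 0
  have hwb : (fun a => w (e (b, a))) = y := by
    ext a
    simp [w]
  have hwb' {b' : B} (h : b' ≠ b) : (fun a => w (e (b', a))) = 0 := by
    ext a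
    simp [w, h]
  have hsyn (b' : B) (i : ℕ) (hi : i < u + v) : blockSyndrome e x w b' i = 0 := by
    by_cases h : b' = b
    · simpa [blockSyndrome, w, h] using hy i hi
    · simp [blockSyndrome, w, h]
  refine ⟨w, mem_localGlobalCode.2 ⟨fun b' i hi => hsyn b' i (by omega), fun i hi =>
    Finset.sum_eq_zero fun b' _ => hsyn b' _ (by omega)⟩, ?_, ?_⟩
  -- If `w` were a check word, its zero block `b'` would force the shared global part `h.2` to
  -- vanish. Then `y` would evaluate a polynomial with only `u` coefficients, so its weight would
  -- exceed `Fintype.card κ - u ≥ u + v + 1`.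
  · rintro ⟨h, hh⟩
    have happ : Fin.append (h.1 b') h.2 = 0 := by
      by_contra hb
      have := card_lt_hammingNorm_checkWord_block_add (e := e) hx hx₀ hb
      rw [hh, hwb' hne.symm, hammingNorm_zero] at this
      omega
    have h₂ (l : Fin v) : h.2 l = 0 := by
      simpa using congrFun happ (Fin.natAdd u l)
    have hyeq : y = fun a => ∑ l, h.1 b l * x a ^ (l + 1 : ℕ) := by
      ext a
      rw [← hwb, ← hh]
      simp [checkWord_apply, Fin.sum_univ_add, h₂]
    have hb₀ : h.1 b ≠ 0 := by
      intro hb₀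
      refine hy₀ (hyeq.trans ?_)
      ext a
      simp [hb₀]
    have := card_lt_hammingNorm_add_of_sum_mul_pow hx hx₀ hb₀
    rw [← hyeq] at this
    omega
  · rw [hammingNorm_eq_sum_blocks e w, Finset.sum_eq_single b, hwb]
    · omega
    · intro b' _ h
      rw [hwb' h, hammingNorm_zero]
    · simp

theorem minDist_localGlobalCode [Nontrivial B] (hx : Function.Injective x)
    (hx₀ : ∀ a, x a ≠ 0) (hvu : v ≤ u) (huv : 2 * u + v < Fintype.card κ) :
    minDist (localGlobalCode e x u v) = ((u + v + 1 : ℕ) : ℕ∞) := by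
  refine le_antisymm ?_ (le_iInf₂ fun c hc => le_iInf fun hc₀ => ?_)
  · obtain ⟨w, hw, -, hww⟩ := exists_minimum_weight_word (e := e) hx hx₀ huv
    rw [← hww]
    refine iInf₂_le_of_le w hw (iInf_le_of_le ?_ le_rfl)
    rw [← hammingNorm_ne_zero_iff, hww]
    omega
  · exact Nat.cast_le.2 (lt_hammingNorm_of_mem_localGlobalCode hx hx₀ hvu hc hc₀)

end MinDist

end Codes

/-! ### Realization as a matrix-product code -/

section MatrixProduct

variable {F : Type*} [Field F] {N : ℕ}

/-- The invertible matrix whose row `z` is the `z`-th unit vector `e_z`, and whose row `i ≠ z` is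
`e_i - e_z`. -/
def unitDiffMatrix (F : Type*) [Field F] {N : ℕ} (z : Fin N) : Matrix (Fin N) (Fin N) F :=
  Matrix.of fun i j => if i = j then 1 else if j = z then -1 else 0

/-- Because of these row sums, adding up all blocks of a codeword isolates the component `c z`. -/
theorem sum_unitDiffMatrix (z i : Fin N) :
    ∑ j, unitDiffMatrix F z i j = if i = z then 1 else 0 := by
  have (j : Fin N) : unitDiffMatrix F z i j =
      (if i = j then 1 else 0) + (if j = z then (if i = z then 0 else -1) else 0) := by
    simp only [unitDiffMatrix, Matrix.of_apply]
    split_ifs <;> simp_all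
  simp only [this, Finset.sum_add_distrib, Finset.sum_ite_eq, Finset.sum_ite_eq', Finset.mem_univ,
    if_true]
  split_ifs <;> simp

theorem mem_matrixProductCode_unitDiffMatrix {ι : Type*} [Fintype ι] {L G : Submodule F (ι → F)}
    (hGL : G ≤ L) (z : Fin N) {w : Fin N × ι → F} :
    w ∈ matrixProductCode (fun i => if i = z then G else L) (unitDiffMatrix F z) ↔
      (∀ j, (fun x => w (j, x)) ∈ L) ∧ (fun x => ∑ j, w (j, x)) ∈ G := by
  constructor
  · rintro ⟨c, hc, hw⟩
    have hcL (i : Fin N) : c i ∈ L := by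
      by_cases h : i = z
      · exact hGL (by simpa [h] using hc i)
      · simpa [h] using hc i
    refine ⟨fun j => ?_, ?_⟩
    · have : (fun x => w (j, x)) = ∑ i, unitDiffMatrix F z i j • c i := by
        ext x
        simp [hw]
      rw [this]
      exact L.sum_mem fun i _ => L.smul_mem _ (hcL i)
    · have : (fun x => ∑ j, w (j, x)) = c z := by
        ext x
        simp only [hw]
        rw [Finset.sum_comm]
        simp [← Finset.sum_mul, sum_unitDiffMatrix]
      rw [this]
      simpa using hc z
  · rintro ⟨hL, hG⟩
    -- The component `z` is the sum of all blocks and every other component is its own block; the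
    -- entries `-1` in column `z` subtract the other blocks again.
    refine ⟨fun i x => if i = z then ∑ j, w (j, x) else w (i, x), fun i => ?_, fun j x => ?_⟩
    · by_cases h : i = z
      · simpa [h] using hG
      · simpa [h] using hL i
    · by_cases hj : j = z
      · subst hj
        rw [← Finset.add_sum_erase _ _ (Finset.mem_univ j)]
        simp only [unitDiffMatrix, Matrix.of_apply, if_true, one_mul]
        rw [← Finset.add_sum_erase Finset.univ (fun i => w (i, x)) (Finset.mem_univ j), add_assoc,
          ← Finset.sum_add_distrib, Finset.sum_eq_zero, add_zero]
        intro i hi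
        simp [Finset.ne_of_mem_erase hi]
      · rw [Finset.sum_eq_single j]
        · simp [unitDiffMatrix, hj]
        · intro i _ hi
          simp [unitDiffMatrix, hj, hi]
        · simp

end MatrixProduct

/-- Syndromes are additive, so the global checks on the sum of the `N` long blocks are exactly the
global checks over all pairs in `Fin N × B`. -/
theorem matrixProductCode_localGlobalCode {F : Type*} [Field F] {N : ℕ} {B κ ι : Type*} [Fintype B]
    [Fintype κ] [Fintype ι] (e : B × κ ≃ ι) (x : κ → F) (u v : ℕ) (z : Fin N) :
    matrixProductCode
      (fun i => if i = z then localGlobalCode e x u v else localGlobalCode e x u 0)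
      (unitDiffMatrix F z) =
    localGlobalCode ((Equiv.prodAssoc (Fin N) B κ).trans (Equiv.prodCongr (Equiv.refl _) e))
      x u v := by
  ext w
  rw [mem_matrixProductCode_unitDiffMatrix]
  · have hsum (b : B) (i : ℕ) : blockSyndrome e x (fun y => ∑ j, w (j, y)) b i =
        ∑ j, blockSyndrome e x (fun y => w (j, y)) b i := by
      simp only [blockSyndrome, Finset.sum_mul]
      rw [Finset.sum_comm]
    simp only [mem_localGlobalCode, hsum, Nat.not_lt_zero, false_imp_iff, implies_true, and_true]
    constructor
    · rintro ⟨h₁, -, h₂⟩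
      refine ⟨fun b => h₁ b.1 b.2, fun i hi => ?_⟩
      rw [Fintype.sum_prod_type, Finset.sum_comm]
      exact h₂ i hi
    · rintro ⟨h₁, h₂⟩
      refine ⟨fun j b => h₁ (j, b), fun b i hi => ?_, fun i hi => ?_⟩
      · exact Finset.sum_eq_zero fun j _ => h₁ (j, b) i hi
      · rw [Finset.sum_comm]
        have := h₂ i hi
        rwa [Fintype.sum_prod_type] at this
  · intro w hw
    rw [mem_localGlobalCode] at hw ⊢
    exact ⟨hw.1, by simp⟩

/-! ### Roots of unity as evaluation points, and the final parameters -/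

section RootsOfUnity

theorem exists_isPrimitiveRoot_of_dvd_card_sub_one {F : Type*} [Field F] [Fintype F] {m : ℕ}
    (hm : m ∣ Fintype.card F - 1) : ∃ ω : F, IsPrimitiveRoot ω m := by
  classical
  obtain ⟨g, hg⟩ := IsCyclic.exists_ofOrder_eq_natCard (α := Fˣ)
  rw [Nat.card_eq_fintype_card, Fintype.card_units] at hg
  obtain ⟨l, hl⟩ := hm
  have hpos : 0 < Fintype.card F - 1 := Nat.sub_pos_of_lt Fintype.one_lt_card
  have h := (IsPrimitiveRoot.orderOf g).pow (a := l) (b := m) (hg ▸ hpos)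
    (by rw [hg, hl, mul_comm])
  exact ⟨_, IsPrimitiveRoot.coe_units_iff.2 h⟩

theorem IsPrimitiveRoot.sum_pow_pow_eq_zero {F : Type*} [Field F] {m : ℕ} {ω : F}
    (hω : IsPrimitiveRoot ω m) {n : ℕ} (hn : 0 < n) (hnm : n < m) :
    ∑ a : Fin m, (ω ^ (a : ℕ)) ^ n = 0 := by
  have h₁ : ω ^ n - 1 ≠ 0 := sub_ne_zero.2 (hω.pow_ne_one_of_pos_of_lt hn.ne' hnm)
  have h₂ := mul_geom_sum (ω ^ n) m
  rw [← pow_mul, mul_comm n m, pow_mul, hω.pow_eq_one, one_pow, sub_self] at h₂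
  rw [← (mul_eq_zero.1 h₂).resolve_left h₁, ← Fin.sum_univ_eq_sum_range]
  refine Finset.sum_congr rfl fun a _ => ?_
  rw [← pow_mul, ← pow_mul, mul_comm]

end RootsOfUnity

/-- A `localGlobalCode` with sufficiently few checks, evaluated at points with vanishing power sums
on a number of blocks that is divisible by the characteristic, induces an optimal quantum
locally recoverable code. -/
theorem inducesOptimalQuantumLRC_localGlobalCode {F : Type*} [Field F] [Fintype F] [DecidableEq F]
    {B κ ι : Type*} [Fintype B] [Nontrivial B] [Fintype κ] [Fintype ι] [DecidableEq ι]
    {e : B × κ ≃ ι} {x : κ → F} {u v k : ℕ} (hx : Function.Injective x) (hx₀ : ∀ a, x a ≠ 0)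
    (hpow : ∀ n, 0 < n → n < Fintype.card κ → ∑ a, x a ^ n = 0)
    (hB : (Fintype.card B : F) = 0) (hu : 0 < u) (hvu : v ≤ u) (huv : 2 * u + v < Fintype.card κ)
    (hk : k + 2 * (Fintype.card B * u + v) = Fintype.card ι) :
    InducesOptimalQuantumLRC (localGlobalCode e x u v) (Fintype.card κ - u) (u + 1)
      (Fintype.card ι) k (u + v + 1) := by
  have hdual : euclideanDual (localGlobalCode e x u v) ≤ localGlobalCode e x u v := by
    rw [euclideanDual_localGlobalCode]
    exact range_checkWord_le_localGlobalCode hpow huv hB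
  have hfin : 2 * Module.finrank F (localGlobalCode e x u v) = Fintype.card ι + k := by
    have := finrank_localGlobalCode_add (e := e) hx hx₀ (u := u) (v := v) (by omega)
    omega
  have hι : Fintype.card ι = Fintype.card B * Fintype.card κ := by
    rw [← Fintype.card_congr e, Fintype.card_prod]
  refine
    { r_pos := by omega
      one_lt_delta := by omega
      dual_le := hdual
      two_mul_finrank := hfin
      isLRC := isLRC_localGlobalCode hx hx₀ (by omega)
      delta_le := add_one_le_minDist_euclideanDual_localGlobalCode hx hx₀ huv
      minDist_eq := minDist_localGlobalCode hx hx₀ hvu huv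
      isQuantumCode := isQuantumCode_inducedQuantumCode hdual hfin
        (fun c hc hc₀ => lt_hammingNorm_of_mem_localGlobalCode hx hx₀ hvu hc hc₀) ?_
      optimal := ?_ }
  · rw [euclideanDual_localGlobalCode]
    exact exists_minimum_weight_word hx hx₀ huv
  · obtain ⟨r, hr⟩ : ∃ r, Fintype.card κ = r + u := ⟨Fintype.card κ - u, by omega⟩
    have hr₀ : (0 : ℚ) < r := by exact_mod_cast (by omega : 0 < r)
    have hvr : (v : ℚ) < r := by exact_mod_cast (by omega : v < r)
    have hn : (Fintype.card ι : ℚ) = Fintype.card B * (r + u) := by rw [hι, hr]; push_cast; rfl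
    have hkq : (k : ℚ) + 2 * (Fintype.card B * u + v) = Fintype.card ι := by exact_mod_cast hk
    -- Here `n + k = 2 * r * |B| - 2 * v` with `0 ≤ v < r`, so the quotient lies in `(|B| - 1,
    -- |B|]`.
    have hceil : ⌈((Fintype.card ι : ℚ) + k) / (2 * (r : ℚ))⌉ = (Fintype.card B : ℤ) := by
      have hv₀ : (0 : ℚ) ≤ v := by positivity
      have heq : (Fintype.card ι : ℚ) + k = Fintype.card B * (2 * r) - 2 * v := by linarith
      rw [Int.ceil_eq_iff, lt_div_iff₀ (by positivity), div_le_iff₀ (by positivity), heq]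
      push_cast
      constructor <;> linarith
    rw [hr, Nat.add_sub_cancel, hceil]
    have hkz : (k : ℤ) + 2 * (Fintype.card B * u + v) = Fintype.card ι := by exact_mod_cast hk
    push_cast
    linear_combination hkz

theorem theorem12 {F : Type*} [Field F] [Fintype F] [DecidableEq F]
    (p e q N s u t m v : ℕ)
    (hp : p.Prime) (hq : q = p ^ e) (hcard : Fintype.card F = q) (hodd : Odd q) (hq5 : 5 ≤ q)
    (hN : 3 ≤ N) (hs : 2 ≤ s) (hqs : q - 1 = (N - 1) * s) (hpN : p ∣ N)
    (hu : 0 < u) (ht : 0 < t) (hm : 0 < m) (hvu : v ≤ u) (huv : 2 * u + v ≤ m - 1)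
    (hmq : m ∣ q - 1) :
    ∃ k : ℕ, (k : ℤ) = (N : ℤ) * t * m - 2 * N * t * u - 2 * v ∧
      ∃ (A : Matrix (Fin N) (Fin N) F) (D : Fin N → Submodule F (Fin (t * m) → F)),
        InducesOptimalQuantumLRC (matrixProductCode D A) (m - u) (u + 1)
          (N * t * m) k (u + v + 1) := by
  obtain ⟨ω, hω⟩ := exists_isPrimitiveRoot_of_dvd_card_sub_one (F := F) (hcard ▸ hmq)
  have hNF : (N : F) = 0 := by
    have h : ((p ^ e : ℕ) : F) = 0 := by rw [← hq, ← hcard, Nat.cast_card_eq_zero]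
    have hpF : (p : F) = 0 := eq_zero_of_pow_eq_zero (by exact_mod_cast h)
    obtain ⟨l, rfl⟩ := hpN
    rw [Nat.cast_mul, hpF, zero_mul]
  -- This makes the natural subtraction defining `k` exact. The slack comes from `m ≥ 2 * u + v + 1`
  -- and `N * t ≥ 3`, so that `2 * v ≤ N * t * v`.
  have hle : 2 * (N * t * u + v) ≤ N * t * m := by
    obtain ⟨d, rfl⟩ : ∃ d, m = 2 * u + v + 1 + d := ⟨m - (2 * u + v + 1), by omega⟩
    have h₁ : 3 * 1 ≤ N * t := Nat.mul_le_mul hN ht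
    have h₂ : 3 * v ≤ N * t * v := Nat.mul_le_mul_right v h₁
    have h₃ : N * t * (2 * u + v + 1 + d) = 2 * (N * t * u) + N * t * v + N * t + N * t * d := by
      ring
    rw [h₃]
    omega
  have hcode := matrixProductCode_localGlobalCode (finProdFinEquiv : Fin t × Fin m ≃ _)
    (fun a => ω ^ (a : ℕ)) u v (⟨0, by omega⟩ : Fin N)
  refine ⟨N * t * m - 2 * (N * t * u + v), ?_, unitDiffMatrix F ⟨0, by omega⟩, _,
    hcode.substr (p := fun C => InducesOptimalQuantumLRC C (m - u) (u + 1) (N * t * m) _ _) ?_⟩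
  · rw [Nat.cast_sub hle]
    push_cast
    ring
  · have : Nontrivial (Fin N × Fin t) := by
      rw [← Fintype.one_lt_card_iff_nontrivial, Fintype.card_prod, Fintype.card_fin,
        Fintype.card_fin]
      nlinarith
    have hι : Fintype.card (Fin N × Fin (t * m)) = N * t * m := by
      simp [mul_assoc]
    have h := inducesOptimalQuantumLRC_localGlobalCode (F := F) (κ := Fin m) (u := u) (v := v)
      (k := N * t * m - 2 * (N * t * u + v))
      (e := (Equiv.prodAssoc (Fin N) (Fin t) (Fin m)).trans
        (Equiv.prodCongr (Equiv.refl _) finProdFinEquiv))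
      (x := fun a : Fin m => ω ^ (a : ℕ))
      (fun a b h => Fin.ext (hω.pow_inj a.2 b.2 h)) (fun a => pow_ne_zero _ (hω.ne_zero hm.ne'))
      (fun n hn hnm => hω.sum_pow_pow_eq_zero hn (by simpa using hnm)) (by simp [hNF]) hu hvu
      (by rw [Fintype.card_fin]; omega)
      (by rw [hι, Fintype.card_prod, Fintype.card_fin, Fintype.card_fin]; omega)
    rw [hι, Fintype.card_fin] at h
    exact h
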